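/- Let $\omega=(\sqrt5-1)/2$, let $P_n(\omega)=\prod_{r=1}^{n}|2\sin(\pi r\omega)|$ for $n\ge 0$ (with $P_0(\omega)=1$), and let $F_1=F_2=1$, $F_{n+1}=F_n+F_{n-1}$ be the Fibonacci numbers. Then the sequence $P_{F_n}(\omega)$ converges, as $n\to\infty$, to a real constant $c$, and, for the same constant $c$, $$\lim_{n\to\infty}\frac{P_{F_n-1}(\omega)}{F_n}=\frac{c\sqrt5}{2\pi}.$$ -/

import Mathlib

open Filter Topology

/-- The golden rotation number `ω = (√5 - 1) / 2`. -/
noncomputable def goldenRotation : ℝ := (Real.sqrt 5 - 1) / 2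

/-- The Sudler sine product `P_n(α) = ∏_{r=1}^{n} |2 sin (π r α)|` (so `P_0(α) = 1`). -/
noncomputable def sudlerProduct (n : ℕ) (α : ℝ) : ℝ :=
  ∏ r ∈ Finset.Icc 1 n, |2 * Real.sin (Real.pi * (r : ℝ) * α)|

/-! ### Equidistribution of the golden rotation -/

/-- An arithmetic progression of length `q` and step coprime to `q` runs through all residues. -/
@[to_additive]
theorem prod_range_emod_of_coprime {M : Type*} [CommMonoid M] {p q : ℕ} (hpq : p.Coprime q)
    (hq : 0 < q) (t : ℤ) (f : ℤ → M) :
    ∏ j ∈ Finset.range q, f ((t + j * p) % q) = ∏ i ∈ Finset.range q, f i := by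
  have hq' : (q : ℤ) ≠ 0 := by exact_mod_cast hq.ne'
  have hnn : ∀ z : ℤ, 0 ≤ z % q := fun z => Int.emod_nonneg z hq'
  have hlt : ∀ z : ℤ, z % q < q := fun z => Int.emod_lt_of_pos z (by exact_mod_cast hq)
  have hmaps : Set.MapsTo (fun j : ℕ => ((t + j * p) % q).toNat)
      (Finset.range q : Finset ℕ) (Finset.range q : Finset ℕ) := by
    intro j _
    have h1 := hnn (t + j * p)
    have h2 := hlt (t + j * p)
    simp only [Finset.coe_range, Set.mem_Iio]
    omega
  have hinj : Set.InjOn (fun j : ℕ => ((t + j * p) % q).toNat) (Finset.range q : Finset ℕ) := by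
    intro j hj k hk hjk
    simp only [Finset.coe_range, Set.mem_Iio] at hj hk hjk
    have h : (t + j * p) % q = (t + k * p) % q := by
      have h1 := hnn (t + j * p)
      have h2 := hnn (t + k * p)
      omega
    have h3 : (j : ℤ) * p ≡ k * p [ZMOD q] := Int.ModEq.add_left_cancel' t h
    have h4 : j * p ≡ k * p [MOD q] := by
      rw [← Int.natCast_modEq_iff]
      push_cast
      exact h3
    have h5 : j ≡ k [MOD q] := Nat.ModEq.cancel_right_of_coprime hpq.symm h4
    exact Nat.ModEq.eq_of_lt_of_lt h5 hj hk
  refine Finset.prod_nbij (fun j : ℕ => ((t + j * p) % q).toNat) hmaps hinj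
    (Finset.surjOn_of_injOn_of_card_le _ hmaps hinj le_rfl) ?_
  intro j _
  rw [Int.toNat_of_nonneg (hnn _)]

theorem sum_fract_add_mul_div {p q : ℕ} (hpq : p.Coprime q) (hq : 0 < q) (β : ℝ) :
    ∑ j ∈ Finset.range q, Int.fract (β + j * (p / q : ℝ)) =
      Int.fract (q * β) + ((q : ℝ) - 1) / 2 := by
  have hq0 : (0 : ℝ) < q := by exact_mod_cast hq
  have hq' : (q : ℤ) ≠ 0 := by exact_mod_cast hq.ne'
  have key : ∀ j : ℕ, Int.fract (β + j * (p / q : ℝ)) =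
      (Int.fract (q * β) + (((⌊q * β⌋ + j * p) % q : ℤ) : ℝ)) / q := by
    intro j
    have h1 : (0 : ℤ) ≤ (⌊q * β⌋ + j * p) % q := Int.emod_nonneg _ hq'
    have h2 : (⌊q * β⌋ + j * p) % q + 1 ≤ (q : ℤ) :=
      Int.emod_lt_of_pos _ (by exact_mod_cast hq)
    have h1' : (0 : ℝ) ≤ (((⌊q * β⌋ + j * p) % q : ℤ) : ℝ) := by exact_mod_cast h1
    have h2' : (((⌊q * β⌋ + j * p) % q : ℤ) : ℝ) + 1 ≤ q := by exact_mod_cast h2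
    have h3 := Int.fract_nonneg (q * β)
    have h4 := Int.fract_lt_one (q * β)
    rw [Int.fract_eq_iff]
    refine ⟨by positivity, by rw [div_lt_one hq0]; linarith, (⌊q * β⌋ + j * p) / q, ?_⟩
    have h5 : (((⌊q * β⌋ + j * p) % q : ℤ) : ℝ) =
        (⌊q * β⌋ + j * p : ℝ) - q * (((⌊q * β⌋ + j * p) / q : ℤ) : ℝ) := by
      rw [Int.emod_def]
      push_cast
      ring
    rw [h5, Int.fract]
    field_simp
    ring
  have hsum : ∑ j ∈ Finset.range q, (((⌊q * β⌋ + j * p) % q : ℤ) : ℝ) =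
      ∑ j ∈ Finset.range q, (j : ℝ) := by
    have := sum_range_emod_of_coprime hpq hq ⌊q * β⌋ (fun z : ℤ => (z : ℝ))
    simpa using this
  have hg : ∑ j ∈ Finset.range q, (j : ℝ) = q * ((q : ℝ) - 1) / 2 := by
    clear * -
    induction q with
    | zero => simp
    | succ n ih => rw [Finset.sum_range_succ, ih]; push_cast; ring
  simp_rw [key]
  rw [← Finset.sum_div, Finset.sum_add_distrib, hsum, hg]
  simp only [Finset.sum_const, Finset.card_range, nsmul_eq_mul]
  field_simp

theorem fract_sub_le_fract {x y δ : ℝ} (h₁ : x ≤ y) (h₂ : y ≤ x + δ) :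
    Int.fract y - δ ≤ Int.fract x := by
  have h : (⌊x⌋ : ℝ) ≤ ⌊y⌋ := by exact_mod_cast Int.floor_mono h₁
  simp only [Int.fract]
  linarith

theorem fract_le_fract_add {x y δ : ℝ} (h₁ : x ≤ y) (h₂ : y ≤ x + δ) :
    Int.fract y ≤ Int.fract x + δ := by
  linarith [fract_sub_le_fract h₁ h₂]

/-- The discrepancy of `q` steps of a rotation is bounded if `p / q` approximates the rotation
number to within `1 / q ^ 2`. -/
theorem abs_sum_fract_sub_half_le {p q : ℕ} (hpq : p.Coprime q) (hq : 0 < q) {α : ℝ}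
    (hα : |q * α - p| ≤ 1 / q) (β : ℝ) :
    |∑ j ∈ Finset.range q, (Int.fract (β + j * α) - 1 / 2)| ≤ 5 / 2 := by
  have hq0 : (0 : ℝ) < q := by exact_mod_cast hq
  have hj : ∀ j ∈ Finset.range q, |(j : ℝ) * α - j * (p / q : ℝ)| ≤ 1 / q := by
    intro j hj
    have hjq : (j : ℝ) ≤ q := by exact_mod_cast (Finset.mem_range.1 hj).le
    have : (j : ℝ) * α - j * (p / q : ℝ) = (j / q) * (q * α - p) := by field_simp
    rw [this, abs_mul, abs_of_nonneg (by positivity)]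
    calc (j / q : ℝ) * |q * α - p| ≤ 1 * (1 / q) := by
          gcongr
          rwa [div_le_one hq0]
      _ = 1 / q := one_mul _
  have hlow : ∑ j ∈ Finset.range q, (Int.fract (β + 1 / q + j * (p / q : ℝ)) - 2 / q) ≤
      ∑ j ∈ Finset.range q, Int.fract (β + j * α) := by
    refine Finset.sum_le_sum fun j hjr => ?_
    have := abs_le.1 (hj j hjr)
    refine fract_sub_le_fract (by linarith) ?_
    have : (2 : ℝ) / q = 1 / q + 1 / q := by ring
    linarith
  have hupp : ∑ j ∈ Finset.range q, Int.fract (β + j * α) ≤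
      ∑ j ∈ Finset.range q, (Int.fract (β - 1 / q + j * (p / q : ℝ)) + 2 / q) := by
    refine Finset.sum_le_sum fun j hjr => ?_
    have := abs_le.1 (hj j hjr)
    refine fract_le_fract_add (by linarith) ?_
    have : (2 : ℝ) / q = 1 / q + 1 / q := by ring
    linarith
  have hc : (q : ℝ) * (2 / q) = 2 := by field_simp
  rw [Finset.sum_sub_distrib, sum_fract_add_mul_div hpq hq, Finset.sum_const, Finset.card_range,
    nsmul_eq_mul, hc] at hlow
  rw [Finset.sum_add_distrib, sum_fract_add_mul_div hpq hq, Finset.sum_const, Finset.card_range,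
    nsmul_eq_mul, hc] at hupp
  have h1 := Int.fract_nonneg (q * (β + 1 / q))
  have h2 := Int.fract_lt_one (q * (β - 1 / q))
  rw [Finset.sum_sub_distrib, Finset.sum_const, Finset.card_range, nsmul_eq_mul, abs_le]
  constructor <;> linarith

theorem goldenRotation_eq_neg_goldenConj : goldenRotation = -Real.goldenConj := by
  unfold goldenRotation Real.goldenConj
  ring

theorem goldenRotation_pos : 0 < goldenRotation := by
  rw [goldenRotation_eq_neg_goldenConj]
  linarith [Real.goldenConj_neg]

theorem goldenRotation_lt_one : goldenRotation < 1 := by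
  rw [goldenRotation_eq_neg_goldenConj]
  linarith [Real.neg_one_lt_goldenConj]

theorem fib_succ_mul_goldenRotation (n : ℕ) :
    (Nat.fib (n + 1) : ℝ) * goldenRotation = Nat.fib n + (-1) ^ n * goldenRotation ^ (n + 1) := by
  have h := Real.goldenConj_mul_fib_succ_add_fib n
  have h' : Real.goldenConj ^ (n + 1) = -((-1) ^ n * goldenRotation ^ (n + 1)) := by
    rw [goldenRotation_eq_neg_goldenConj, neg_pow Real.goldenConj, pow_succ (-1 : ℝ) n]
    have : ((-1 : ℝ) ^ n) * (-1) ^ n = 1 := by rw [← mul_pow]; simp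
    linear_combination (-Real.goldenConj ^ (n + 1)) * this
  rw [goldenRotation_eq_neg_goldenConj] at h' ⊢
  linarith

theorem fib_mul_goldenRotation_pow (n : ℕ) :
    (Nat.fib n : ℝ) * goldenRotation ^ n = (1 - (-goldenRotation ^ 2) ^ n) / √5 := by
  have h1 : Real.goldenRatio * goldenRotation = 1 := by
    rw [goldenRotation_eq_neg_goldenConj]
    linarith [Real.goldenRatio_mul_goldenConj]
  have h2 : Real.goldenConj * goldenRotation = -goldenRotation ^ 2 := by
    rw [goldenRotation_eq_neg_goldenConj]
    ring
  rw [Real.coe_fib_eq, div_mul_eq_mul_div, sub_mul, ← mul_pow, ← mul_pow, h1, h2, one_pow]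

theorem fib_mul_goldenRotation_pow_le (n : ℕ) :
    (Nat.fib n : ℝ) * goldenRotation ^ n ≤ 2 / √5 := by
  rw [fib_mul_goldenRotation_pow]
  have h : |(-goldenRotation ^ 2) ^ n| ≤ 1 := by
    rw [abs_pow, abs_neg, abs_of_nonneg (by positivity)]
    exact pow_le_one₀ (by positivity)
      (pow_le_one₀ goldenRotation_pos.le goldenRotation_lt_one.le)
  gcongr
  linarith [neg_abs_le ((-goldenRotation ^ 2) ^ n)]

theorem two_div_sqrt_five_lt_one : 2 / √5 < 1 := by
  rw [div_lt_one (by positivity)]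
  exact Real.lt_sqrt_of_sq_lt (by norm_num)

theorem tendsto_fib_mul_goldenRotation_pow :
    Tendsto (fun n : ℕ => (Nat.fib n : ℝ) * goldenRotation ^ n) atTop (𝓝 (1 / √5)) := by
  simp_rw [fib_mul_goldenRotation_pow]
  have h : Tendsto (fun n : ℕ => (-goldenRotation ^ 2) ^ n) atTop (𝓝 0) := by
    apply tendsto_pow_atTop_nhds_zero_of_abs_lt_one
    rw [abs_neg, abs_of_nonneg (by positivity)]
    exact pow_lt_one₀ goldenRotation_pos.le goldenRotation_lt_one two_ne_zero
  simpa using (h.const_sub 1).div_const √5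

theorem abs_sum_fract_goldenRotation_le (m : ℕ) (β : ℝ) :
    |∑ j ∈ Finset.range m, (Int.fract (β + j * goldenRotation) - 1 / 2)| ≤ 9 * √m := by
  induction m using Nat.strong_induction_on generalizing β with
  | _ m ih =>
  rcases Nat.eq_zero_or_pos m with rfl | hm
  · simp
  obtain ⟨k, hk⟩ : ∃ k, Nat.greatestFib m = k + 1 :=
    Nat.exists_eq_succ_of_ne_zero (Nat.greatestFib_ne_zero.2 hm.ne')
  have hle : Nat.fib (k + 1) ≤ m := hk ▸ Nat.fib_greatestFib_le m
  have hlt : m < Nat.fib (k + 2) := by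
    have := Nat.lt_fib_greatestFib_add_one m
    rwa [hk] at this
  have hlt2 : m < 2 * Nat.fib (k + 1) := by
    have h1 : Nat.fib (k + 2) = Nat.fib k + Nat.fib (k + 1) := Nat.fib_add_two
    have h2 : Nat.fib k ≤ Nat.fib (k + 1) := Nat.fib_le_fib_succ
    omega
  have hpos : 0 < Nat.fib (k + 1) := Nat.fib_pos.2 (Nat.succ_pos k)
  obtain ⟨l, rfl⟩ := Nat.exists_eq_add_of_le hle
  set q := Nat.fib (k + 1) with hq
  have hq0 : (0 : ℝ) < q := by exact_mod_cast hpos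
  have happ : |q * goldenRotation - Nat.fib k| ≤ 1 / q := by
    rw [hq, fib_succ_mul_goldenRotation, add_sub_cancel_left, abs_mul, abs_pow, abs_neg, abs_one,
      one_pow, one_mul, abs_of_pos (pow_pos goldenRotation_pos _), ← hq, le_div_iff₀ hq0, mul_comm]
    exact (fib_mul_goldenRotation_pow_le (k + 1)).trans two_div_sqrt_five_lt_one.le
  have h1 := abs_sum_fract_sub_half_le (Nat.fib_coprime_fib_succ k) hpos happ β
  have h2 := ih l (by omega) (β + q * goldenRotation)
  rw [Finset.sum_range_add]
  have h3 : ∀ j : ℕ, β + ((q + j : ℕ) : ℝ) * goldenRotation =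
      β + q * goldenRotation + j * goldenRotation := by
    intro j
    push_cast
    ring
  simp_rw [h3]
  refine (abs_add_le _ _).trans ((add_le_add h1 h2).trans ?_)
  have hl : (l : ℝ) ≤ q := by exact_mod_cast (by omega : l ≤ q)
  have hs1 : (1 : ℝ) ≤ √((q + l : ℕ) : ℝ) := by
    rw [Real.one_le_sqrt]
    exact_mod_cast (by omega : 1 ≤ q + l)
  have hs2 : √(l : ℝ) ≤ 13 / 18 * √((q + l : ℕ) : ℝ) := by
    refine Real.sqrt_le_iff.2 ⟨by positivity, ?_⟩
    rw [mul_pow, Real.sq_sqrt (by positivity)]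
    push_cast
    have : (0 : ℝ) ≤ l := by positivity
    linarith
  linarith

/-! ### Convergence of sums of logarithms of sine quotients -/

theorem tendsto_sum_range_of_dominated {f : ℕ → ℕ → ℝ} {g bound : ℕ → ℝ} {N : ℕ → ℕ}
    (hN : Tendsto N atTop atTop) (hbound : Summable bound) (hnn : ∀ i, 0 ≤ bound i)
    (hfg : ∀ i, Tendsto (fun n => f n i) atTop (𝓝 (g i)))
    (hf : ∀ᶠ n in atTop, ∀ i < N n, |f n i| ≤ bound i) :
    Tendsto (fun n => ∑ i ∈ Finset.range (N n), f n i) atTop (𝓝 (∑' i, g i)) := by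
  have h : ∀ n, ∑ i ∈ Finset.range (N n), f n i = ∑' i, if i < N n then f n i else 0 := by
    intro n
    rw [tsum_eq_sum (s := Finset.range (N n))]
    · exact Finset.sum_congr rfl fun i hi => by rw [if_pos (Finset.mem_range.1 hi)]
    · intro i hi
      rw [if_neg (by simpa using hi)]
  simp_rw [h]
  refine tendsto_tsum_of_dominated_convergence hbound (fun i => ?_) ?_
  · refine (hfg i).congr' ?_
    filter_upwards [hN.eventually_gt_atTop i] with n hn
    rw [if_pos hn]
  · filter_upwards [hf] with n hn i
    split_ifs with hi
    · exact hn i hi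
    · simpa using hnn i

theorem sum_range_mul_eq_by_parts (d c : ℕ → ℝ) (N : ℕ) :
    ∑ i ∈ Finset.range N, d i * c i = (∑ i ∈ Finset.range N, d i) * c N +
      ∑ i ∈ Finset.range N, (∑ j ∈ Finset.range (i + 1), d j) * (c i - c (i + 1)) := by
  induction N with
  | zero => simp
  | succ N ih =>
    rw [Finset.sum_range_succ, ih, Finset.sum_range_succ _ N,
      Finset.sum_range_succ (fun i => (∑ j ∈ Finset.range (i + 1), d j) * (c i - c (i + 1)))]
    rw [Finset.sum_range_succ d N]
    ring

theorem two_div_pi_mul_le_sin {x y : ℝ} (hy : 0 ≤ y) (h₁ : y ≤ x) (h₂ : y ≤ Real.pi - x) :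
    2 / Real.pi * y ≤ Real.sin x := by
  rcases le_total x (Real.pi / 2) with h | h
  · exact le_trans (by gcongr) (Real.mul_le_sin (hy.trans h₁) h)
  · rw [← Real.sin_pi_sub]
    exact le_trans (by gcongr) (Real.mul_le_sin (hy.trans h₂) (by linarith))

theorem cot_sub_cot {x y : ℝ} (hx : Real.sin x ≠ 0) (hy : Real.sin y ≠ 0) :
    Real.cot x - Real.cot y = Real.sin (y - x) / (Real.sin x * Real.sin y) := by
  rw [Real.cot_eq_cos_div_sin, Real.cot_eq_cos_div_sin, Real.sin_sub]
  field_simp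

theorem two_div_pi_mul_le_sin_sub {A b ρ : ℝ} (hA : 0 < A) (hA' : A ≤ Real.pi / 2) (hρ : ρ ≤ 1)
    (hb : |b| ≤ ρ * A) : 2 / Real.pi * ((1 - ρ) * A) ≤ Real.sin (A - b) := by
  have h := abs_le.1 hb
  exact two_div_pi_mul_le_sin (mul_nonneg (by linarith) hA.le) (by linarith) (by nlinarith)

/-- The quadratic remainder in the Taylor expansion of `log (sin (A - b) / sin A)` in `b`. -/
theorem abs_log_sin_sub_div_sin_add_le {A b ρ : ℝ} (hA : 0 < A) (hA' : A ≤ Real.pi / 2)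
    (hρ : ρ < 1) (hb : |b| ≤ ρ * A) :
    |Real.log (Real.sin (A - b) / Real.sin A) + b * Real.cot A| ≤
      (Real.pi / 2) ^ 2 / (1 - ρ) * (b / A) ^ 2 := by
  have hpi := Real.pi_pos
  have hρ0 : 0 < 1 - ρ := by linarith
  have hsA : 2 / Real.pi * A ≤ Real.sin A :=
    two_div_pi_mul_le_sin hA.le le_rfl (by linarith)
  have hsA0 : 0 < Real.sin A := lt_of_lt_of_le (by positivity) hsA
  have hs : ∀ t ∈ Set.Icc (-|b|) |b|, 2 / Real.pi * ((1 - ρ) * A) ≤ Real.sin (A - t) :=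
    fun t ht => two_div_pi_mul_le_sin_sub hA hA' hρ.le ((abs_le.2 ht).trans hb)
  have hs0 : ∀ t ∈ Set.Icc (-|b|) |b|, 0 < Real.sin (A - t) :=
    fun t ht => lt_of_lt_of_le (by positivity) (hs t ht)
  have hder : ∀ t ∈ Set.Icc (-|b|) |b|,
      HasDerivWithinAt (fun t => Real.log (Real.sin (A - t)) + t * Real.cot A)
        (Real.cot A - Real.cot (A - t)) (Set.Icc (-|b|) |b|) t := by
    intro t ht
    have h1 : HasDerivAt (fun t => Real.sin (A - t)) (-Real.cos (A - t)) t := by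
      simpa using ((hasDerivAt_id t).const_sub A).sin
    have h2 := (h1.log (hs0 t ht).ne').add ((hasDerivAt_id t).mul_const (Real.cot A))
    refine (h2.congr_deriv ?_).hasDerivWithinAt
    rw [Real.cot_eq_cos_div_sin (A - t)]
    ring
  have hbd : ∀ t ∈ Set.Icc (-|b|) |b|, ‖Real.cot A - Real.cot (A - t)‖ ≤
      |b| / ((2 / Real.pi * A) * (2 / Real.pi * ((1 - ρ) * A))) := by
    intro t ht
    have ht' := abs_le.2 ht
    rw [cot_sub_cot hsA0.ne' (hs0 t ht).ne', Real.norm_eq_abs, abs_div,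
      abs_of_pos (mul_pos hsA0 (hs0 t ht))]
    have h3 : |Real.sin (A - t - A)| ≤ |b| := by
      refine Real.abs_sin_le_abs.trans ?_
      rwa [show A - t - A = -t by ring, abs_neg]
    gcongr
    exact hs t ht
  have h := (convex_Icc (-|b|) |b|).norm_image_sub_le_of_norm_hasDerivWithin_le hder hbd
    (x := 0) (y := b) (by simp) ⟨neg_abs_le b, le_abs_self b⟩
  have hb0 := hs0 b ⟨neg_abs_le b, le_abs_self b⟩
  rw [Real.log_div hb0.ne' hsA0.ne']
  simp only [sub_zero, zero_mul, add_zero, Real.norm_eq_abs] at h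
  rw [show Real.log (Real.sin (A - b)) - Real.log (Real.sin A) + b * Real.cot A =
    Real.log (Real.sin (A - b)) + b * Real.cot A - Real.log (Real.sin A) by ring]
  refine h.trans (le_of_eq ?_)
  rw [div_pow b, ← sq_abs b]
  field_simp

/-- If `q n * θ n → l` with `q n → ∞`, then also `q n * sin (θ n) → l`. -/
theorem tendsto_mul_sin {q : ℕ → ℕ} {θ : ℕ → ℝ} {l : ℝ} (hq : Tendsto q atTop atTop)
    (h : Tendsto (fun n => q n * θ n) atTop (𝓝 l)) :
    Tendsto θ atTop (𝓝 0) ∧ Tendsto (fun n => q n * Real.sin (θ n)) atTop (𝓝 l) := by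
  have hq' : Tendsto (fun n => (q n : ℝ)) atTop atTop := tendsto_natCast_atTop_atTop.comp hq
  have h0 : Tendsto θ atTop (𝓝 0) := by
    refine (h.div_atTop hq').congr' ?_
    filter_upwards [hq.eventually_gt_atTop 0] with n hn
    have : (q n : ℝ) ≠ 0 := by exact_mod_cast hn.ne'
    field_simp
  refine ⟨h0, ?_⟩
  have h1 : Tendsto (fun n => Real.sinc (θ n)) atTop (𝓝 1) := by
    simpa [Function.comp_def] using (Real.continuous_sinc.tendsto 0).comp h0
  have h2 := h.mul h1
  rw [mul_one] at h2
  refine h2.congr fun n => ?_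
  by_cases hz : θ n = 0
  · simp [hz]
  · rw [Real.sinc_of_ne_zero hz]
    field_simp

theorem tendsto_mul_cot {q : ℕ → ℕ} {w A : ℕ → ℝ} {κ l : ℝ} (hq : Tendsto q atTop atTop)
    (hw : Tendsto (fun n => q n * w n) atTop (𝓝 κ))
    (hA : Tendsto (fun n => q n * A n) atTop (𝓝 l)) (hl : l ≠ 0) :
    Tendsto (fun n => w n * Real.cot (A n)) atTop (𝓝 (κ / l)) := by
  obtain ⟨h0, h1⟩ := tendsto_mul_sin hq hA
  have h2 : Tendsto (fun n => Real.cos (A n)) atTop (𝓝 1) := by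
    simpa [Function.comp_def] using (Real.continuous_cos.tendsto 0).comp h0
  have h3 := (hw.mul h2).div h1 hl
  rw [mul_one] at h3
  refine h3.congr' ?_
  filter_upwards [hq.eventually_gt_atTop 0] with n hn
  have : (q n : ℝ) ≠ 0 := by exact_mod_cast hn.ne'
  simp only [Pi.div_apply]
  rw [Real.cot_eq_cos_div_sin, mul_assoc, mul_div_mul_left _ _ this, mul_div_assoc]

theorem tendsto_mul_pi_mul_div {q : ℕ → ℕ} (hq : Tendsto q atTop atTop) (x : ℝ) :
    Tendsto (fun n => q n * (Real.pi * (x / q n))) atTop (𝓝 (Real.pi * x)) := by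
  refine tendsto_const_nhds.congr' ?_
  filter_upwards [hq.eventually_gt_atTop 0] with n hn
  have : (q n : ℝ) ≠ 0 := by exact_mod_cast hn.ne'
  field_simp

theorem summable_sqrt_div_sq : Summable fun i : ℕ => √((i : ℝ) + 1) / ((i : ℝ) + 1) ^ 2 := by
  have h := (summable_nat_add_iff 1).2
    (Real.summable_one_div_nat_rpow.2 (by norm_num : (1 : ℝ) < 3 / 2))
  refine h.congr fun i => ?_
  have hi : (0 : ℝ) < (i : ℝ) + 1 := by positivity
  push_cast
  rw [Real.sqrt_eq_rpow, ← Real.rpow_natCast, ← Real.rpow_sub hi, one_div, ← Real.rpow_neg hi.le]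
  norm_num

theorem summable_one_div_succ_sq : Summable fun i : ℕ => 1 / ((i : ℝ) + 1) ^ 2 := by
  have h := (summable_nat_add_iff 1).2
    (Real.summable_one_div_nat_pow.2 (by norm_num : 1 < 2))
  simpa using h

theorem abs_cot_le {x y : ℝ} (hy : 0 < y) (h₁ : y ≤ x) (h₂ : y ≤ Real.pi - x) :
    |Real.cot x| ≤ Real.pi / (2 * y) := by
  have hpi := Real.pi_pos
  have hs := two_div_pi_mul_le_sin hy.le h₁ h₂
  have hs0 : 0 < 2 / Real.pi * y := by positivity
  rw [Real.cot_eq_cos_div_sin, abs_div, abs_of_pos (hs0.trans_le hs)]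
  calc |Real.cos x| / Real.sin x ≤ 1 / (2 / Real.pi * y) := by
        gcongr
        exact Real.abs_cos_le_one x
    _ = Real.pi / (2 * y) := by field_simp

section
variable {q N : ℕ → ℕ} {w : ℕ → ℝ} {u : ℕ → ℕ → ℝ} {y : ℕ → ℝ} {κ ρ C s : ℝ}

theorem exists_tendsto_sum_log_remainder (hq : Tendsto q atTop atTop)
    (hN : Tendsto N atTop atTop) (hNq : ∀ n, 2 * N n ≤ q n)
    (hw : Tendsto (fun n => q n * w n) atTop (𝓝 κ)) (hwρ : ∀ n, |q n * w n| ≤ ρ) (hρ : ρ < 1)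
    (hu : ∀ n, ∀ i < N n, |u n i| ≤ 1) (huy : ∀ n, ∀ i < N n, |u n i - y i| ≤ 1 / q n)
    (hy : ∀ i, |y i| ≤ 1) :
    ∃ L, Tendsto (fun n => ∑ i ∈ Finset.range (N n),
      (Real.log (Real.sin (Real.pi * ((i + 1) / q n) - Real.pi * w n * u n i) /
          Real.sin (Real.pi * ((i + 1) / q n))) +
        Real.pi * w n * y i * Real.cot (Real.pi * ((i + 1) / q n)))) atTop (𝓝 L) := by
  have hpi := Real.pi_pos
  have hρ0 : 0 ≤ ρ := (abs_nonneg _).trans (hwρ 0)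
  have hκ : |κ| ≤ ρ := le_of_tendsto hw.abs (Eventually.of_forall hwρ)
  refine ⟨_, tendsto_sum_range_of_dominated hN (g := fun i =>
      Real.log (Real.pi * (i + 1 - κ * y i) / (Real.pi * (i + 1))) +
        y i * (Real.pi * κ / (Real.pi * (i + 1))))
    (summable_one_div_succ_sq.mul_left ((Real.pi / 2) ^ 2 / (1 - ρ) + Real.pi))
    (fun i => by have : 0 < 1 - ρ := by linarith
                 positivity) (fun i => ?_) (Eventually.of_forall fun n i hi => ?_)⟩
  · have hi : (0 : ℝ) < (i : ℝ) + 1 := by positivity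
    have hA := tendsto_mul_pi_mul_div hq ((i : ℝ) + 1)
    have hui : Tendsto (fun n => u n i) atTop (𝓝 (y i)) := by
      rw [tendsto_iff_dist_tendsto_zero]
      have h0 : Tendsto (fun n => 1 / (q n : ℝ)) atTop (𝓝 0) :=
        tendsto_const_nhds.div_atTop (tendsto_natCast_atTop_atTop.comp hq)
      refine squeeze_zero' (Eventually.of_forall fun n => dist_nonneg) ?_ h0
      filter_upwards [hN.eventually_gt_atTop i] with n hn
      exact huy n i hn
    have hB : Tendsto (fun n => q n * (Real.pi * ((i + 1) / q n) - Real.pi * w n * u n i)) atTop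
        (𝓝 (Real.pi * (i + 1 - κ * y i))) := by
      have h := hA.sub ((hw.mul hui).const_mul Real.pi)
      rw [← mul_sub] at h
      refine h.congr fun n => ?_
      ring
    have hpos : 0 < (i : ℝ) + 1 - κ * y i := by
      have h1 : |κ * y i| ≤ ρ * 1 := by
        rw [abs_mul]
        exact mul_le_mul hκ (hy i) (abs_nonneg _) hρ0
      have h2 := le_abs_self (κ * y i)
      have h3 : (0 : ℝ) ≤ i := by positivity
      linarith
    refine Tendsto.add ?_ ?_
    · have h := ((tendsto_mul_sin hq hB).2.div (tendsto_mul_sin hq hA).2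
        (by positivity)).log (by positivity)
      refine h.congr' ?_
      filter_upwards [hq.eventually_gt_atTop 0] with n hn
      have : (q n : ℝ) ≠ 0 := by exact_mod_cast hn.ne'
      simp only [Pi.div_apply]
      rw [mul_div_mul_left _ _ this]
    · have hw' : Tendsto (fun n => q n * (Real.pi * w n)) atTop (𝓝 (Real.pi * κ)) :=
        (hw.const_mul Real.pi).congr fun n => by ring
      refine ((tendsto_mul_cot hq hw' hA (by positivity)).const_mul (y i)).congr fun n => ?_
      ring
  · have hi0 : (0 : ℝ) < (i : ℝ) + 1 := by positivity
    have hiq : 2 * ((i : ℝ) + 1) ≤ q n := by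
      have := hNq n
      exact_mod_cast (by omega : 2 * (i + 1) ≤ q n)
    have hq0 : (0 : ℝ) < q n := by linarith
    have hwn : |w n| ≤ ρ / q n := by
      have := hwρ n
      rw [abs_mul, abs_of_pos hq0] at this
      rw [le_div_iff₀ hq0]
      linarith
    set A := Real.pi * (((i : ℝ) + 1) / q n) with hAdef
    have hA : 0 < A := by positivity
    have hA2 : A ≤ Real.pi / 2 := by
      rw [hAdef, div_eq_mul_one_div Real.pi 2]
      gcongr Real.pi * ?_
      rw [div_le_div_iff₀ hq0 two_pos]
      linarith
    have hb' : |Real.pi * w n * u n i| ≤ Real.pi * (ρ / q n) * 1 := by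
      rw [abs_mul, abs_mul, abs_of_pos hpi]
      gcongr
      exact hu n i hi
    have hb : |Real.pi * w n * u n i| ≤ ρ * A := by
      refine hb'.trans ?_
      rw [hAdef, mul_one, mul_left_comm]
      gcongr
      rw [← mul_div_assoc]
      gcongr
      nlinarith [(Nat.cast_nonneg i : (0 : ℝ) ≤ i)]
    have hbA : (Real.pi * w n * u n i / A) ^ 2 ≤ 1 / ((i : ℝ) + 1) ^ 2 := by
      rw [← sq_abs, abs_div, abs_of_pos hA, ← one_div_pow]
      gcongr ?_ ^ 2
      rw [div_le_div_iff₀ hA hi0]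
      calc |Real.pi * w n * u n i| * ((i : ℝ) + 1) ≤
            (Real.pi * (1 / q n) * 1) * ((i : ℝ) + 1) := by
            gcongr
            exact hb'.trans (by gcongr)
        _ = 1 * A := by rw [hAdef]; ring
    have h1 := abs_log_sin_sub_div_sin_add_le hA hA2 hρ hb
    have h2 : |Real.pi * w n * (y i - u n i) * Real.cot A| ≤
        Real.pi * (1 / ((i : ℝ) + 1) ^ 2) := by
      have hc := abs_cot_le hA le_rfl (by linarith)
      rw [abs_mul, abs_mul, abs_mul, abs_of_pos hpi, abs_sub_comm]
      calc Real.pi * |w n| * |u n i - y i| * |Real.cot A| ≤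
            Real.pi * (1 / q n) * (1 / q n) * (Real.pi / (2 * A)) := by
            gcongr
            · exact hwn.trans (by gcongr)
            · exact huy n i hi
        _ = Real.pi * (1 / (2 * q n * (i + 1))) := by rw [hAdef]; field_simp
        _ ≤ Real.pi * (1 / ((i : ℝ) + 1) ^ 2) := by
            gcongr
            nlinarith
    rw [show Real.log (Real.sin (A - Real.pi * w n * u n i) / Real.sin A) +
        Real.pi * w n * y i * Real.cot A =
      (Real.log (Real.sin (A - Real.pi * w n * u n i) / Real.sin A) +
        Real.pi * w n * u n i * Real.cot A) +
        Real.pi * w n * (y i - u n i) * Real.cot A by ring]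
    have h3 : 0 < 1 - ρ := by linarith
    refine (abs_add_le _ _).trans ?_
    rw [add_mul]
    refine add_le_add (h1.trans ?_) h2
    gcongr

theorem exists_tendsto_sum_mul_cot (hq : Tendsto q atTop atTop)
    (hN : Tendsto N atTop atTop) (hNq : ∀ n, 2 * N n ≤ q n)
    (hw : Tendsto (fun n => q n * w n) atTop (𝓝 κ)) {d : ℕ → ℝ} (hC : 0 ≤ C)
    (hd : ∀ k, |∑ i ∈ Finset.range k, d i| ≤ C * √k) :
    ∃ L, Tendsto (fun n => ∑ i ∈ Finset.range (N n),
      d i * (w n * Real.cot (Real.pi * ((i + 1) / q n)))) atTop (𝓝 L) := by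
  have hpi := Real.pi_pos
  obtain ⟨ρ, hρ⟩ : ∃ ρ, ∀ᶠ n in atTop, |q n * w n| ≤ ρ :=
    ⟨|κ| + 1, (hw.abs.eventually_lt_const (lt_add_one _)).mono fun _ h => h.le⟩
  have hρ0 : 0 ≤ ρ := by
    obtain ⟨n, hn⟩ := hρ.exists
    exact (abs_nonneg _).trans hn
  have hw' : ∀ᶠ n in atTop, 4 ≤ q n ∧ |w n| ≤ ρ / q n := by
    filter_upwards [hρ, hq.eventually_ge_atTop 4] with n hn h4
    have hq0 : (0 : ℝ) < q n := by exact_mod_cast (by omega : 0 < q n)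
    rw [abs_mul, abs_of_pos hq0] at hn
    refine ⟨h4, ?_⟩
    rw [le_div_iff₀ hq0]
    linarith
  have hreal : ∀ n i, 4 ≤ q n → i < N n → (4 : ℝ) ≤ q n ∧ 2 * ((i : ℝ) + 1) ≤ q n := by
    intro n i h4 hi
    have := hNq n
    exact ⟨by exact_mod_cast h4, by exact_mod_cast (by omega : 2 * (i + 1) ≤ q n)⟩
  have hnext : ∀ n i, 4 ≤ q n → i < N n →
      Real.pi * (((i : ℝ) + 1) / q n) / 2 ≤ Real.pi * (((i + 1 : ℕ) + 1) / q n) ∧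
      Real.pi * (((i : ℝ) + 1) / q n) / 2 ≤
        Real.pi - Real.pi * (((i + 1 : ℕ) + 1) / q n) := by
    intro n i h4 hi
    obtain ⟨h4', hiq⟩ := hreal n i h4 hi
    have hi0 : (0 : ℝ) ≤ i := by positivity
    have hq0 : (0 : ℝ) < q n := by linarith
    push_cast
    have h5 : Real.pi - Real.pi * (((i : ℝ) + 1 + 1) / q n) =
        Real.pi * ((q n - (i + 1 + 1)) / q n) := by
      field_simp
    rw [h5, mul_div_assoc, div_div]
    constructor <;>
    · gcongr Real.pi * ?_
      rw [div_le_div_iff₀ (by positivity) hq0]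
      nlinarith
  simp_rw [sum_range_mul_eq_by_parts d]
  have hb : Tendsto (fun n => (∑ i ∈ Finset.range (N n), d i) *
      (w n * Real.cot (Real.pi * (((N n : ℕ) + 1) / q n)))) atTop (𝓝 0) := by
    have h0 : Tendsto (fun n => C * ρ * (1 / √(N n))) atTop (𝓝 0) := by
      have : Tendsto (fun n => 1 / √(N n : ℝ)) atTop (𝓝 0) :=
        tendsto_const_nhds.div_atTop
          (Real.tendsto_sqrt_atTop.comp (tendsto_natCast_atTop_atTop.comp hN))
      simpa using this.const_mul (C * ρ)
    refine squeeze_zero_norm' ?_ h0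
    filter_upwards [hw', hN.eventually_gt_atTop 0] with n ⟨h4, hwn⟩ hN0
    obtain ⟨i, hi⟩ := Nat.exists_eq_succ_of_ne_zero hN0.ne'
    have hq0 : (0 : ℝ) < q n := by exact_mod_cast (by omega : 0 < q n)
    have hx := hnext n i h4 (by omega)
    have hc := abs_cot_le (by positivity) hx.1 hx.2
    rw [← Nat.succ_eq_add_one, ← hi] at hc
    have hiN : ((i : ℝ) + 1) = N n := by rw [hi]; push_cast; ring
    rw [hiN] at hc
    have hNpos : (0 : ℝ) < N n := by exact_mod_cast hN0
    rw [Real.norm_eq_abs, abs_mul, abs_mul]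
    calc _ ≤ (C * √(N n)) * (ρ / q n * (Real.pi / (2 * (Real.pi * ((N n : ℝ) / q n) / 2)))) := by
          gcongr
          exact hd _
      _ = C * ρ * (√(N n) / N n) := by field_simp
      _ = C * ρ * (1 / √(N n)) := by rw [Real.sqrt_div_self']
  have hlim : ∀ i : ℕ, Tendsto (fun n => w n * Real.cot (Real.pi * (((i : ℝ) + 1) / q n))) atTop
      (𝓝 (κ / (Real.pi * (i + 1)))) := fun i =>
    tendsto_mul_cot hq hw (tendsto_mul_pi_mul_div hq ((i : ℝ) + 1)) (by positivity)
  refine ⟨_, hb.add (tendsto_sum_range_of_dominated hN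
    (summable_sqrt_div_sq.mul_left (C * ρ * Real.pi ^ 2)) (fun i => by positivity)
    (fun i => ((hlim i).sub (hlim (i + 1))).const_mul _) ?_)⟩
  filter_upwards [hw'] with n ⟨h4, hwn⟩ i hi
  obtain ⟨h4', hiq⟩ := hreal n i h4 hi
  have hq0 : (0 : ℝ) < q n := by linarith
  have hx := hnext n i h4 hi
  have hA : 0 < Real.pi * (((i : ℝ) + 1) / q n) := by positivity
  have hA2 : Real.pi * (((i : ℝ) + 1) / q n) ≤ Real.pi / 2 := by
    rw [div_eq_mul_one_div Real.pi 2]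
    gcongr Real.pi * ?_
    rw [div_le_div_iff₀ hq0 two_pos]
    linarith
  have hs1 := two_div_pi_mul_le_sin hA.le le_rfl (by linarith)
  have hs2 := two_div_pi_mul_le_sin (by positivity) hx.1 hx.2
  have hs1' := lt_of_lt_of_le (by positivity) hs1
  have hs2' := lt_of_lt_of_le (by positivity) hs2
  rw [← mul_sub, cot_sub_cot hs1'.ne' hs2'.ne', abs_mul, abs_mul, abs_div,
    abs_of_pos (mul_pos hs1' hs2')]
  have hsin : |Real.sin (Real.pi * (((i + 1 : ℕ) + 1) / q n) - Real.pi * (((i : ℝ) + 1) / q n))| ≤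
      Real.pi / q n := by
    refine Real.abs_sin_le_abs.trans (le_of_eq ?_)
    rw [show Real.pi * (((i + 1 : ℕ) + 1) / q n) - Real.pi * (((i : ℝ) + 1) / q n) =
      Real.pi / q n by push_cast; ring, abs_of_pos (by positivity)]
  have hdi := hd (i + 1)
  push_cast at hdi
  calc _ ≤ (C * √((i : ℝ) + 1)) * (ρ / q n * (Real.pi / q n /
        ((2 / Real.pi * (Real.pi * (((i : ℝ) + 1) / q n))) *
          (2 / Real.pi * (Real.pi * (((i : ℝ) + 1) / q n) / 2))))) := by
        gcongr
    _ = C * ρ * (Real.pi / 2) * (√((i : ℝ) + 1) / ((i : ℝ) + 1) ^ 2) := by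
        field_simp
    _ ≤ C * ρ * Real.pi ^ 2 * (√((i : ℝ) + 1) / ((i : ℝ) + 1) ^ 2) := by
        gcongr
        nlinarith [Real.pi_gt_three]

theorem exists_tendsto_sum_log_sin (hq : Tendsto q atTop atTop)
    (hN : Tendsto N atTop atTop) (hNq : ∀ n, 2 * N n ≤ q n)
    (hw : Tendsto (fun n => q n * w n) atTop (𝓝 κ)) (hwρ : ∀ n, |q n * w n| ≤ ρ) (hρ : ρ < 1)
    (hu : ∀ n, ∀ i < N n, |u n i| ≤ 1) (huy : ∀ n, ∀ i < N n, |u n i - y i| ≤ 1 / q n)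
    (hy : ∀ i, |y i| ≤ 1) (hC : 0 ≤ C)
    (hd : ∀ k, |∑ i ∈ Finset.range k, (y i - s)| ≤ C * √k) :
    ∃ L, Tendsto (fun n => ∑ i ∈ Finset.range (N n),
      (Real.log (Real.sin (Real.pi * ((i + 1) / q n) - Real.pi * w n * u n i) /
          Real.sin (Real.pi * ((i + 1) / q n))) +
        Real.pi * w n * s * Real.cot (Real.pi * ((i + 1) / q n)))) atTop (𝓝 L) := by
  obtain ⟨L₁, h₁⟩ := exists_tendsto_sum_log_remainder hq hN hNq hw hwρ hρ hu huy hy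
  obtain ⟨L₂, h₂⟩ := exists_tendsto_sum_mul_cot hq hN hNq hw hC hd
  refine ⟨_, (h₁.sub (h₂.const_mul Real.pi)).congr fun n => ?_⟩
  rw [Finset.mul_sum, ← Finset.sum_sub_distrib]
  exact Finset.sum_congr rfl fun i _ => by ring

end

/-! ### Sine products at Fibonacci indices -/

theorem prod_two_mul_sin_pi_div (q : ℕ) (hq : 0 < q) :
    ∏ i ∈ Finset.range (q - 1), |2 * Real.sin (Real.pi * ((i + 1) / q))| = q := by
  obtain ⟨n, rfl⟩ : ∃ n, q = n + 1 := Nat.exists_eq_succ_of_ne_zero hq.ne'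
  have h := congrArg norm
    (Complex.isPrimitiveRoot_exp (n + 1) n.succ_ne_zero).prod_one_sub_pow_eq_order
  rw [norm_prod] at h
  have h2 : ‖((n : ℂ) + 1)‖ = ((n + 1 : ℕ) : ℝ) := by
    rw [← Nat.cast_add_one, Complex.norm_natCast]
  rw [h2] at h
  rw [Nat.add_sub_cancel]
  refine Eq.trans ?_ h
  refine Finset.prod_congr rfl fun i _ => ?_
  rw [norm_sub_rev, ← Complex.exp_nat_mul,
    show ((i + 1 : ℕ) : ℂ) * (2 * Real.pi * Complex.I / ((n + 1 : ℕ) : ℂ)) =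
      Complex.I * ((2 * (Real.pi * ((i + 1) / (n + 1 : ℕ))) : ℝ) : ℂ) by
        push_cast
        field_simp,
    Complex.norm_exp_I_mul_ofReal_sub_one, Real.norm_eq_abs, mul_div_cancel_left₀ _ two_ne_zero]

theorem fib_sq_add_neg_one_pow (n : ℕ) :
    (Nat.fib n : ℝ) ^ 2 + (-1) ^ n = Nat.fib (n + 1) * (Nat.fib (n + 1) - Nat.fib n) := by
  induction n with
  | zero => simp
  | succ n ih =>
    have h : (Nat.fib (n + 2) : ℝ) = Nat.fib n + Nat.fib (n + 1) := by
      exact_mod_cast Nat.fib_add_two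
    rw [h, pow_succ (-1 : ℝ) n]
    linear_combination -ih

/-- `m F_n / F_{n+1}` modulo one. -/
noncomputable def fibResidue (n m : ℕ) : ℝ :=
  ((m * Nat.fib n % Nat.fib (n + 1) : ℕ) : ℝ) / Nat.fib (n + 1)

theorem fib_succ_pos (n : ℕ) : 0 < Nat.fib (n + 1) := Nat.fib_pos.2 n.succ_pos

theorem fibResidue_nonneg (n m : ℕ) : 0 ≤ fibResidue n m := by
  unfold fibResidue
  positivity

theorem fibResidue_le_one (n m : ℕ) : fibResidue n m ≤ 1 := by
  have h := fib_succ_pos n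
  rw [fibResidue, div_le_one (by exact_mod_cast h)]
  exact_mod_cast (Nat.mod_lt _ h).le

theorem mul_fib_mod_ne_zero {n m : ℕ} (h₀ : 0 < m) (h₁ : m < Nat.fib (n + 1)) :
    m * Nat.fib n % Nat.fib (n + 1) ≠ 0 := by
  intro h
  have h2 : Nat.fib (n + 1) ∣ m :=
    (Nat.fib_coprime_fib_succ n).symm.dvd_of_dvd_mul_right (Nat.dvd_of_mod_eq_zero h)
  exact absurd (Nat.le_of_dvd h₀ h2) (by omega)

theorem abs_fibResidue_sub_fract_le {n m : ℕ} (h₀ : 0 < m) (h₁ : m < Nat.fib (n + 1)) :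
    |fibResidue n m - Int.fract (m * goldenRotation)| ≤ 1 / Nat.fib (n + 1) := by
  have hq := fib_succ_pos n
  have hq0 : (0 : ℝ) < Nat.fib (n + 1) := by exact_mod_cast hq
  set q := Nat.fib (n + 1) with hqdef
  set r := m * Nat.fib n % q with hr
  set ε : ℝ := (-1) ^ n * goldenRotation ^ (n + 1) with hε
  have hr1 : (1 : ℝ) ≤ r := by
    exact_mod_cast Nat.one_le_iff_ne_zero.2 (mul_fib_mod_ne_zero h₀ h₁)
  have hr2 : (r : ℝ) + 1 ≤ q := by exact_mod_cast Nat.mod_lt _ hq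
  have hmε : |m * ε| < 1 := by
    rw [hε, abs_mul, abs_mul, abs_pow, abs_neg, abs_one, one_pow, one_mul,
      abs_of_pos (pow_pos goldenRotation_pos _), Nat.abs_cast]
    calc (m : ℝ) * goldenRotation ^ (n + 1) ≤ q * goldenRotation ^ (n + 1) := by
          gcongr
          exact pow_nonneg goldenRotation_pos.le _
      _ ≤ 2 / √5 := fib_mul_goldenRotation_pow_le _
      _ < 1 := two_div_sqrt_five_lt_one
  have hmε' := abs_lt.1 hmε
  have hdiv : (m : ℝ) * Nat.fib n = q * (m * Nat.fib n / q : ℕ) + r := by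
    exact_mod_cast (Nat.div_add_mod (m * Nat.fib n) q).symm
  have hω : (q : ℝ) * goldenRotation = Nat.fib n + ε := fib_succ_mul_goldenRotation n
  have hfr : Int.fract (m * goldenRotation) = (r + m * ε) / q := by
    rw [Int.fract_eq_iff]
    refine ⟨div_nonneg (by linarith) hq0.le, by rw [div_lt_one hq0]; linarith,
      (m * Nat.fib n / q : ℕ), ?_⟩
    rw [Int.cast_natCast]
    field_simp
    linear_combination m * hω + hdiv
  rw [hfr, fibResidue, ← hr, ← sub_div, sub_add_cancel_left, abs_div, abs_neg, abs_of_pos hq0]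
  gcongr

theorem fibResidue_sub {n m : ℕ} (h₀ : 0 < m) (h₁ : m < Nat.fib (n + 1)) :
    fibResidue n (Nat.fib (n + 1) - m) = 1 - fibResidue n m := by
  have hq := fib_succ_pos n
  have hq0 : (Nat.fib (n + 1) : ℝ) ≠ 0 := by exact_mod_cast hq.ne'
  have hr := mul_fib_mod_ne_zero h₀ h₁
  have hr2 := Nat.mod_lt (m * Nat.fib n) hq
  have h : (Nat.fib (n + 1) - m) * Nat.fib n % Nat.fib (n + 1) =
      Nat.fib (n + 1) - m * Nat.fib n % Nat.fib (n + 1) := by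
    have h3 : ((Nat.fib (n + 1) - m) * Nat.fib n) ≡
        Nat.fib (n + 1) - m * Nat.fib n % Nat.fib (n + 1) [MOD Nat.fib (n + 1)] := by
      refine Nat.ModEq.add_right_cancel' (m * Nat.fib n) ?_
      rw [← add_mul, Nat.sub_add_cancel h₁.le]
      calc Nat.fib (n + 1) * Nat.fib n ≡ 0 [MOD Nat.fib (n + 1)] :=
            (Nat.modEq_zero_iff_dvd.2 (dvd_mul_right _ _))
        _ ≡ Nat.fib (n + 1) [MOD Nat.fib (n + 1)] :=
            (Nat.modEq_zero_iff_dvd.2 dvd_rfl).symm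
        _ = Nat.fib (n + 1) - m * Nat.fib n % Nat.fib (n + 1) +
              m * Nat.fib n % Nat.fib (n + 1) := (Nat.sub_add_cancel hr2.le).symm
        _ ≡ _ [MOD Nat.fib (n + 1)] := Nat.ModEq.add_left _ (Nat.mod_modEq _ _)
    rw [h3, Nat.mod_eq_of_lt (by omega)]
  rw [fibResidue, fibResidue, h, Nat.cast_sub hr2.le, sub_div, div_self hq0]

theorem abs_sin_residue_mul_goldenRotation (n m : ℕ) :
    |Real.sin (Real.pi * ((m * Nat.fib n % Nat.fib (n + 1) : ℕ) : ℝ) * goldenRotation)| =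
      |Real.sin (Real.pi * (m / Nat.fib (n + 1)) -
        Real.pi * goldenRotation ^ (n + 1) * fibResidue n m)| := by
  have hq := fib_succ_pos n
  have hq0 : (Nat.fib (n + 1) : ℝ) ≠ 0 := by exact_mod_cast hq.ne'
  have hdiv : (m : ℝ) * Nat.fib n = Nat.fib (n + 1) * (m * Nat.fib n / Nat.fib (n + 1) : ℕ) +
      (m * Nat.fib n % Nat.fib (n + 1) : ℕ) := by
    exact_mod_cast (Nat.div_add_mod (m * Nat.fib n) (Nat.fib (n + 1))).symm
  have hω := fib_succ_mul_goldenRotation n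
  have hsq := fib_sq_add_neg_one_pow n
  unfold fibResidue
  generalize (m * Nat.fib n % Nat.fib (n + 1)) = r at *
  generalize (m * Nat.fib n / Nat.fib (n + 1)) = l at *
  generalize goldenRotation ^ (n + 1) = w at *
  have key : (r : ℝ) * goldenRotation =
      (((m * (Nat.fib (n + 1) - Nat.fib n) - l * Nat.fib n : ℤ)) : ℝ) -
        (-1) ^ n * (m / Nat.fib (n + 1) - w * (r / Nat.fib (n + 1))) := by
    push_cast
    field_simp
    linear_combination r * hω - (Nat.fib n : ℝ) * hdiv + m * hsq
  set B := Real.pi * ((m : ℝ) / Nat.fib (n + 1)) - Real.pi * w * (r / Nat.fib (n + 1)) with hB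
  have key2 : Real.pi * r * goldenRotation =
      ((m * (Nat.fib (n + 1) - Nat.fib n) - l * Nat.fib n : ℤ) : ℝ) * Real.pi - (-1) ^ n * B := by
    rw [hB, mul_assoc, key]
    ring
  rw [key2, Real.sin_int_mul_pi_sub, abs_neg, abs_mul, abs_zpow, abs_neg, abs_one, one_zpow,
    one_mul]
  rcases neg_one_pow_eq_or ℝ n with h | h <;> rw [h] <;> simp

theorem sudlerProduct_eq_prod_residue (n : ℕ) :
    sudlerProduct (Nat.fib (n + 1) - 1) goldenRotation =
      ∏ i ∈ Finset.range (Nat.fib (n + 1) - 1),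
        |2 * Real.sin (Real.pi * ((i + 1) / Nat.fib (n + 1)) -
          Real.pi * goldenRotation ^ (n + 1) * fibResidue n (i + 1))| := by
  obtain ⟨k, hk⟩ := Nat.exists_eq_succ_of_ne_zero (fib_succ_pos n).ne'
  let f : ℤ → ℝ := fun z => if z = 0 then 1 else |2 * Real.sin (Real.pi * z * goldenRotation)|
  have h := prod_range_emod_of_coprime (Nat.fib_coprime_fib_succ n) (fib_succ_pos n) 0 f
  have hLHS : sudlerProduct (Nat.fib (n + 1) - 1) goldenRotation =
      ∏ i ∈ Finset.range (Nat.fib (n + 1)), f i := by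
    rw [sudlerProduct, hk, Nat.succ_eq_add_one, Nat.add_sub_cancel, Finset.prod_range_succ',
      Finset.range_eq_Ico, Finset.prod_Ico_add' (fun i : ℕ => f i) 0 k 1]
    have h0 : f ((0 : ℕ) : ℤ) = 1 := by simp [f]
    rw [h0, mul_one]
    refine Finset.prod_congr rfl fun r hr => ?_
    have hr0 : r ≠ 0 := by
      have := (Finset.mem_Ico.1 hr).1
      omega
    simp [f, hr0]
  rw [hLHS, ← h]
  have hsplit : Finset.range (Nat.fib (n + 1)) = Finset.range (Nat.fib (n + 1) - 1 + 1) := by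
    rw [Nat.sub_add_cancel (fib_succ_pos n)]
  rw [hsplit, Finset.prod_range_succ']
  have h0 : f ((0 + ((0 : ℕ) : ℤ) * (Nat.fib n : ℤ)) % (Nat.fib (n + 1) : ℤ)) = 1 := by simp [f]
  rw [h0, mul_one]
  refine Finset.prod_congr rfl fun i hi => ?_
  have hi' := Finset.mem_range.1 hi
  have hne := mul_fib_mod_ne_zero (n := n) i.succ_pos (by omega)
  have hcast : (0 + ((i + 1 : ℕ) : ℤ) * (Nat.fib n : ℤ)) % (Nat.fib (n + 1) : ℤ) =
      (((i + 1) * Nat.fib n % Nat.fib (n + 1) : ℕ) : ℤ) := by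
    push_cast
    ring_nf
  have hne' : (((i + 1) * Nat.fib n % Nat.fib (n + 1) : ℕ) : ℤ) ≠ 0 := by exact_mod_cast hne
  have hs := abs_sin_residue_mul_goldenRotation n (i + 1)
  rw [hcast]
  simp only [f, if_neg hne', Int.cast_natCast]
  rw [abs_mul, hs, abs_mul]
  push_cast
  rfl

/-- The logarithm of the `m`-th factor of `P_{q-1}(ω) / q`, where `q = F_{n+1}`. -/
noncomputable def logFactor (n m : ℕ) : ℝ :=
  Real.log (Real.sin (Real.pi * (m / Nat.fib (n + 1)) -
      Real.pi * goldenRotation ^ (n + 1) * fibResidue n m) /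
    Real.sin (Real.pi * (m / Nat.fib (n + 1))))

theorem sin_pi_mul_div_pos {q m : ℕ} (h₀ : 0 < m) (h₁ : m < q) :
    0 < Real.sin (Real.pi * ((m : ℝ) / q)) := by
  have hq0 : (0 : ℝ) < q := by exact_mod_cast h₀.trans h₁
  have hm0 : (0 : ℝ) < m := by exact_mod_cast h₀
  have : (m : ℝ) / q < 1 := by
    rw [div_lt_one hq0]
    exact_mod_cast h₁
  exact Real.sin_pos_of_pos_of_lt_pi (by positivity) (by nlinarith [Real.pi_pos])

theorem sin_sub_fibResidue_pos {n m : ℕ} (h₀ : 0 < m) (h₁ : m < Nat.fib (n + 1)) :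
    0 < Real.sin (Real.pi * (m / Nat.fib (n + 1)) -
      Real.pi * goldenRotation ^ (n + 1) * fibResidue n m) := by
  have hpi := Real.pi_pos
  have hq0 : (0 : ℝ) < Nat.fib (n + 1) := by exact_mod_cast h₀.trans h₁
  have hm0 : (1 : ℝ) ≤ m := by exact_mod_cast h₀
  have hw0 := pow_pos goldenRotation_pos (n + 1)
  have hx0 := fibResidue_nonneg n m
  have hx1 := fibResidue_le_one n m
  have hmq : (m : ℝ) / Nat.fib (n + 1) < 1 := by
    rw [div_lt_one hq0]
    exact_mod_cast h₁
  have hwx : goldenRotation ^ (n + 1) * fibResidue n m < m / Nat.fib (n + 1) := by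
    rw [lt_div_iff₀ hq0]
    calc goldenRotation ^ (n + 1) * fibResidue n m * Nat.fib (n + 1) ≤
          goldenRotation ^ (n + 1) * 1 * Nat.fib (n + 1) := by gcongr
      _ = Nat.fib (n + 1) * goldenRotation ^ (n + 1) := by ring
      _ ≤ 2 / √5 := fib_mul_goldenRotation_pow_le _
      _ < 1 := two_div_sqrt_five_lt_one
      _ ≤ m := hm0
  have hwx0 : 0 ≤ goldenRotation ^ (n + 1) * fibResidue n m := by positivity
  rw [mul_assoc, ← mul_sub]
  exact Real.sin_pos_of_pos_of_lt_pi (mul_pos hpi (by linarith)) (by nlinarith)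

theorem sudlerProduct_div_fib_eq_exp (n : ℕ) :
    sudlerProduct (Nat.fib (n + 1) - 1) goldenRotation / Nat.fib (n + 1) =
      Real.exp (∑ i ∈ Finset.range (Nat.fib (n + 1) - 1), logFactor n (i + 1)) := by
  have h := prod_two_mul_sin_pi_div _ (fib_succ_pos n)
  rw [Real.exp_sum, sudlerProduct_eq_prod_residue, eq_comm]
  refine Eq.trans ?_ (congrArg _ h)
  rw [← Finset.prod_div_distrib]
  refine Finset.prod_congr rfl fun i hi => ?_
  have hi' := Finset.mem_range.1 hi
  have h1 := sin_sub_fibResidue_pos (n := n) i.succ_pos (by omega)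
  have h2 := sin_pi_mul_div_pos (q := Nat.fib (n + 1)) i.succ_pos (by omega)
  rw [logFactor, Real.exp_log (div_pos h1 h2)]
  rw [Nat.succ_eq_add_one, Nat.cast_add_one] at h1 h2
  rw [Nat.cast_add_one, abs_of_pos (mul_pos two_pos h1), abs_of_pos (mul_pos two_pos h2),
    mul_div_mul_left _ _ two_ne_zero]

theorem logFactor_sub {n m : ℕ} (h₀ : 0 < m) (h₁ : m < Nat.fib (n + 1)) :
    logFactor n (Nat.fib (n + 1) - m) =
      Real.log (Real.sin (Real.pi * (m / Nat.fib (n + 1)) -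
          Real.pi * goldenRotation ^ (n + 1) * (fibResidue n m - 1)) /
        Real.sin (Real.pi * (m / Nat.fib (n + 1)))) := by
  have hq0 : (Nat.fib (n + 1) : ℝ) ≠ 0 := by exact_mod_cast (h₀.trans h₁).ne'
  rw [logFactor, fibResidue_sub h₀ h₁, Nat.cast_sub h₁.le, sub_div, div_self hq0,
    ← Real.sin_pi_sub (Real.pi * ((m : ℝ) / Nat.fib (n + 1))),
    ← Real.sin_pi_sub (Real.pi * ((m : ℝ) / Nat.fib (n + 1)) - _)]
  ring_nf

theorem sum_range_sub_one_eq_add_reflect (f : ℕ → ℝ) (q : ℕ) :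
    ∑ i ∈ Finset.range (q - 1), f (i + 1) = ∑ i ∈ Finset.range (q - 1 - q / 2), f (i + 1) +
      ∑ i ∈ Finset.range (q / 2), f (q - (i + 1)) := by
  rcases Nat.eq_zero_or_pos q with rfl | hq
  · simp
  have h : q - 1 = (q - 1 - q / 2) + q / 2 := by omega
  conv_lhs => rw [h, Finset.sum_range_add]
  congr 1
  rw [← Finset.sum_range_reflect]
  refine Finset.sum_congr rfl fun i hi => ?_
  have := Finset.mem_range.1 hi
  congr 1
  omega

theorem sum_cot_half (q : ℕ) (hq : 0 < q) :
    ∑ i ∈ Finset.range (q - 1 - q / 2), Real.cot (Real.pi * (((i : ℝ) + 1) / q)) =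
      ∑ i ∈ Finset.range (q / 2), Real.cot (Real.pi * (((i : ℝ) + 1) / q)) := by
  rcases Nat.even_or_odd' q with ⟨k, rfl | rfl⟩
  · obtain ⟨l, rfl⟩ := Nat.exists_eq_succ_of_ne_zero (by omega : k ≠ 0)
    rw [show 2 * l.succ - 1 - 2 * l.succ / 2 = l by omega,
      show 2 * l.succ / 2 = l + 1 by omega, Finset.sum_range_succ]
    have h : Real.pi * (((l : ℝ) + 1) / ((2 * l.succ : ℕ) : ℝ)) = Real.pi / 2 := by
      push_cast
      field_simp
    rw [h, Real.cot_eq_cos_div_sin, Real.cos_pi_div_two, zero_div, add_zero]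
  · rw [show 2 * k + 1 - 1 - (2 * k + 1) / 2 = (2 * k + 1) / 2 by omega]

theorem tendsto_fib_succ_atTop : Tendsto (fun n => Nat.fib (n + 1)) atTop atTop := by
  refine tendsto_atTop_mono (fun n => ?_) tendsto_id
  have := Nat.le_fib_add_one (n + 1)
  simp only [id]
  omega

theorem tendsto_half_fib_succ_atTop : Tendsto (fun n => Nat.fib (n + 1) / 2) atTop atTop :=
  (Nat.tendsto_div_const_atTop two_ne_zero).comp tendsto_fib_succ_atTop

theorem abs_sum_fract_succ_mul_goldenRotation_le (k : ℕ) :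
    |∑ i ∈ Finset.range k, (Int.fract (((i + 1 : ℕ) : ℝ) * goldenRotation) - 1 / 2)| ≤
      9 * √k := by
  have h := abs_sum_fract_goldenRotation_le k goldenRotation
  have h2 : ∀ j : ℕ, ((j + 1 : ℕ) : ℝ) * goldenRotation = goldenRotation + j * goldenRotation := by
    intro j
    push_cast
    ring
  simp_rw [h2]
  exact h

theorem exists_tendsto_sum_logFactor :
    ∃ L, Tendsto (fun n => ∑ i ∈ Finset.range (Nat.fib (n + 1) - 1), logFactor n (i + 1))
      atTop (𝓝 L) := by
  have hw := (tendsto_add_atTop_iff_nat 1).2 tendsto_fib_mul_goldenRotation_pow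
  have hwρ : ∀ n : ℕ, |(Nat.fib (n + 1) : ℝ) * goldenRotation ^ (n + 1)| ≤ 2 / √5 := by
    intro n
    rw [abs_of_nonneg (mul_nonneg (Nat.cast_nonneg _) (pow_nonneg goldenRotation_pos.le _))]
    exact fib_mul_goldenRotation_pow_le _
  have hN : Tendsto (fun n => Nat.fib (n + 1) - 1 - Nat.fib (n + 1) / 2) atTop atTop := by
    refine tendsto_atTop_mono (f := fun n => Nat.fib (n + 1) / 2 - 1) (fun n => by omega) ?_
    exact (tendsto_sub_atTop_nat 1).comp tendsto_half_fib_succ_atTop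
  have hfr : ∀ x : ℝ, 0 ≤ Int.fract x ∧ Int.fract x < 1 :=
    fun x => ⟨Int.fract_nonneg x, Int.fract_lt_one x⟩
  obtain ⟨L₁, h₁⟩ := exists_tendsto_sum_log_sin (s := 1 / 2) (C := 9)
    (u := fun n i => fibResidue n (i + 1))
    (y := fun i => Int.fract (((i + 1 : ℕ) : ℝ) * goldenRotation))
    tendsto_fib_succ_atTop hN (fun n => by omega) hw hwρ two_div_sqrt_five_lt_one
    (fun n i _ => abs_le.2 ⟨by linarith [fibResidue_nonneg n (i + 1)], fibResidue_le_one _ _⟩)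
    (fun n i hi => abs_fibResidue_sub_fract_le i.succ_pos (by omega))
    (fun i => abs_le.2 ⟨by linarith [(hfr (((i + 1 : ℕ) : ℝ) * goldenRotation)).1],
      (hfr _).2.le⟩) (by norm_num)
    abs_sum_fract_succ_mul_goldenRotation_le
  obtain ⟨L₂, h₂⟩ := exists_tendsto_sum_log_sin (s := -(1 / 2)) (C := 9)
    (u := fun n i => fibResidue n (i + 1) - 1)
    (y := fun i => Int.fract (((i + 1 : ℕ) : ℝ) * goldenRotation) - 1)
    tendsto_fib_succ_atTop tendsto_half_fib_succ_atTop (fun n => by omega) hw hwρ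
    two_div_sqrt_five_lt_one
    (fun n i _ => abs_le.2 ⟨by linarith [fibResidue_nonneg n (i + 1)],
      by linarith [fibResidue_le_one n (i + 1)]⟩)
    (fun n i hi => by
      have := fib_succ_pos n
      rw [sub_sub_sub_cancel_right]
      exact abs_fibResidue_sub_fract_le i.succ_pos (by omega))
    (fun i => abs_le.2 ⟨by linarith [(hfr (((i + 1 : ℕ) : ℝ) * goldenRotation)).1],
      by linarith [(hfr (((i + 1 : ℕ) : ℝ) * goldenRotation)).2]⟩) (by norm_num)
    (fun k => by
      refine le_of_eq_of_le ?_ (abs_sum_fract_succ_mul_goldenRotation_le k)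
      congr 1
      exact Finset.sum_congr rfl fun i _ => by ring)
  refine ⟨L₁ + L₂, (h₁.add h₂).congr fun n => ?_⟩
  have hq := fib_succ_pos n
  rw [sum_range_sub_one_eq_add_reflect (logFactor n), Finset.sum_add_distrib,
    Finset.sum_add_distrib, ← Finset.mul_sum, ← Finset.mul_sum, sum_cot_half _ hq]
  have e₁ : ∀ i ∈ Finset.range (Nat.fib (n + 1) / 2), logFactor n (Nat.fib (n + 1) - (i + 1)) =
      Real.log (Real.sin (Real.pi * (((i : ℝ) + 1) / Nat.fib (n + 1)) -
          Real.pi * goldenRotation ^ (n + 1) * (fibResidue n (i + 1) - 1)) /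
        Real.sin (Real.pi * (((i : ℝ) + 1) / Nat.fib (n + 1)))) := by
    intro i hi
    have hi' := Finset.mem_range.1 hi
    rw [logFactor_sub i.succ_pos (by omega), Nat.succ_eq_add_one, Nat.cast_add_one]
  rw [Finset.sum_congr rfl e₁]
  simp only [logFactor, Nat.cast_add_one]
  ring

theorem sudlerProduct_fib_succ (n : ℕ) :
    sudlerProduct (Nat.fib (n + 1)) goldenRotation =
      sudlerProduct (Nat.fib (n + 1) - 1) goldenRotation / Nat.fib (n + 1) *
        |2 * (Nat.fib (n + 1) * Real.sin (Real.pi * goldenRotation ^ (n + 1)))| := by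
  obtain ⟨k, hk⟩ := Nat.exists_eq_succ_of_ne_zero (fib_succ_pos n).ne'
  have hq0 : (0 : ℝ) < Nat.fib (n + 1) := by exact_mod_cast fib_succ_pos n
  have h1 : sudlerProduct (Nat.fib (n + 1)) goldenRotation =
      sudlerProduct (Nat.fib (n + 1) - 1) goldenRotation *
        |2 * Real.sin (Real.pi * (Nat.fib (n + 1) : ℝ) * goldenRotation)| := by
    rw [sudlerProduct, sudlerProduct, hk, Nat.succ_eq_add_one, Nat.add_sub_cancel,
      Finset.prod_Icc_succ_top (by omega)]
  have h2 : |Real.sin (Real.pi * (Nat.fib (n + 1) : ℝ) * goldenRotation)| =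
      |Real.sin (Real.pi * goldenRotation ^ (n + 1))| := by
    rw [mul_assoc, fib_succ_mul_goldenRotation,
      show Real.pi * ((Nat.fib n : ℝ) + (-1) ^ n * goldenRotation ^ (n + 1)) =
        (-1) ^ n * (Real.pi * goldenRotation ^ (n + 1)) + Nat.fib n * Real.pi by ring,
      Real.sin_add_nat_mul_pi, abs_mul, abs_pow, abs_neg, abs_one, one_pow, one_mul]
    rcases neg_one_pow_eq_or ℝ n with h | h <;> rw [h] <;> simp
  rw [h1, abs_mul, h2, abs_mul, abs_mul, abs_of_pos hq0]
  field_simp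

theorem mainTheorem4 :
    ∃ c : ℝ,
      Tendsto (fun n : ℕ => sudlerProduct (Nat.fib n) goldenRotation) atTop (𝓝 c) ∧
      Tendsto (fun n : ℕ => sudlerProduct (Nat.fib n - 1) goldenRotation / (Nat.fib n : ℝ))
        atTop (𝓝 (c * Real.sqrt 5 / (2 * Real.pi))) := by
  obtain ⟨L, hL⟩ := exists_tendsto_sum_logFactor
  have hquot : Tendsto (fun n : ℕ =>
      sudlerProduct (Nat.fib (n + 1) - 1) goldenRotation / (Nat.fib (n + 1) : ℝ))
      atTop (𝓝 (Real.exp L)) :=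
    ((Real.continuous_exp.tendsto L).comp hL).congr
      fun n => (sudlerProduct_div_fib_eq_exp n).symm
  have hw := (tendsto_add_atTop_iff_nat 1).2 tendsto_fib_mul_goldenRotation_pow
  have hsin := (tendsto_mul_sin tendsto_fib_succ_atTop
    ((hw.const_mul Real.pi).congr fun n => mul_left_comm _ _ _)).2
  refine ⟨Real.exp L * (2 * (Real.pi * (1 / √5))), ?_, ?_⟩
  · rw [← tendsto_add_atTop_iff_nat 1]
    have h := hquot.mul (hsin.const_mul 2).abs
    rw [abs_of_pos (by have := Real.pi_pos; positivity)] at h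
    exact h.congr fun n => (sudlerProduct_fib_succ n).symm
  · rw [← tendsto_add_atTop_iff_nat 1]
    have hc : Real.exp L * (2 * (Real.pi * (1 / √5))) * √5 / (2 * Real.pi) = Real.exp L := by
      have := Real.pi_pos
      field_simp
    rw [hc]
    exact hquot
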